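/- Let $p,q$ be positive integers. In a strict $(p,q)$ Avoider-Enforcer game on a finite board $X$ with a family $\mathcal F\subseteq 2^X$ of target sets, two players, Avoider and Enforcer, move alternately; in each move Avoider claims exactly $p$, and Enforcer exactly $q$, previously unclaimed elements of $X$, except that a player who finds fewer unclaimed elements than that claims all of them. The game ends when all elements of $X$ have been claimed. Avoider loses if he has then claimed all the elements of some $F\in\mathcal F$; otherwise Avoider wins. For positive integers $n,k$, let $mBox(n\times k,(p,q))$ be this game for a family $\mathcal F=\{B_1,\dots,B_n\}$ of $n$ pairwise disjoint sets (boxes) of size $k$ each, on the board $X=B_1\cup\dots\cup B_n$. Let $p,q,k$ be positive integers. Then there exists an integer $N=N(p,q,k)$ such that for every $n\ge N$, and whichever of the two players moves first, Enforcer has a winning strategy in the game $mBox(n\times k,(p,q))$ if and only if $\gcd(p+q,\ell)\le p$ for every integer $1\le \ell\le k$. -/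

import Mathlib

namespace AvoiderEnforcer

/-- The two players. -/
inductive Player where
  | avoider
  | enforcer
  deriving DecidableEq

/-- The opponent of a player. -/
def Player.other : Player → Player
  | .avoider => .enforcer
  | .enforcer => .avoider

/-- A strict `(p, q)` Avoider-Enforcer game on the board `X`: the number of elements each player
claims per move (`p` for Avoider, `q` for Enforcer) and the family of target sets. -/
structure Game (X : Type*) where
  /-- Avoider's bias -/
  p : ℕ
  /-- Enforcer's bias -/
  q : ℕ
  /-- the target sets -/
  targets : Set (Finset X)

namespace Game

/-- The number of elements that a player has to claim per move. -/
def bias {X : Type*} (G : Game X) : Player → ℕ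
  | .avoider => G.p
  | .enforcer => G.q

end Game

/-- A history is the list of the moves made so far, the most recent move first; a move is the set of
elements that are claimed in it. -/
abbrev History (X : Type*) := List (Finset X)

namespace History

variable {X : Type*}

/-- The player whose turn it is after the history `h`, when `first` begins the game. -/
def turn (first : Player) : History X → Player
  | [] => first
  | _ :: h => (turn first h).other

variable [DecidableEq X]

/-- The set of elements claimed by player `P` during the history `h`. -/
def claimedBy (first P : Player) : History X → Finset X
  | [] => ∅
  | M :: h => if turn first h = P then M ∪ claimedBy first P h else claimedBy first P h

/-- The set of elements of the board that nobody has claimed yet. -/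
def unclaimed [Fintype X] (first : Player) (h : History X) : Finset X :=
  Finset.univ \ (claimedBy first .avoider h ∪ claimedBy first .enforcer h)

end History

namespace Game

variable {X : Type*} [Fintype X] [DecidableEq X]

/-- `M` is a legal move after the history `h`: the player to move claims previously unclaimed
elements, exactly as many as his bias says, or all the unclaimed elements if there are fewer. -/
def IsLegalMove (G : Game X) (first : Player) (h : History X) (M : Finset X) : Prop :=
  M ⊆ h.unclaimed first ∧
    M.card = min (G.bias (h.turn first)) (h.unclaimed first).card

/-- The game has ended: all elements of the board have been claimed. -/
def IsOver (first : Player) (h : History X) : Prop := h.unclaimed first = ∅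

/-- The histories that can arise when `first` begins, Enforcer answers every history by the move
that the strategy `σ` prescribes and Avoider makes arbitrary legal moves. -/
inductive Consistent (G : Game X) (first : Player) (σ : History X → Finset X) :
    History X → Prop
  | start : Consistent G first σ []
  | avoiderMove (h : History X) (M : Finset X) : Consistent G first σ h → ¬ IsOver first h →
      h.turn first = .avoider → G.IsLegalMove first h M → Consistent G first σ (M :: h)
  | enforcerMove (h : History X) : Consistent G first σ h → ¬ IsOver first h →
      h.turn first = .enforcer → Consistent G first σ (σ h :: h)

/-- Avoider has lost: he has claimed all the elements of some target set. -/
def AvoiderLost (G : Game X) (first : Player) (h : History X) : Prop :=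
  ∃ F ∈ G.targets, F ⊆ h.claimedBy first .avoider

/-- Enforcer has a winning strategy when `first` begins the game: a strategy that always prescribes
legal moves and with which Avoider has lost whenever the game has ended. -/
def EnforcerHasWinningStrategy (G : Game X) (first : Player) : Prop :=
  ∃ σ : History X → Finset X,
    (∀ h, G.Consistent first σ h → ¬ IsOver first h → h.turn first = .enforcer →
      G.IsLegalMove first h (σ h)) ∧
    (∀ h, G.Consistent first σ h → IsOver first h → G.AvoiderLost first h)

end Game

/-- The `i`-th of the pairwise disjoint boxes of sizes `b 0, …, b (n - 1)`. -/
def box {n : ℕ} (b : Fin n → ℕ) (i : Fin n) : Finset ((i : Fin n) × Fin (b i)) :=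
  Finset.univ.filter fun x => x.1 = i

/-- The misère box game `mBox(b₁, …, bₙ, (p, q))`: the board is the disjoint union of the boxes and
the boxes are the target sets. -/
def mBox {n : ℕ} (b : Fin n → ℕ) (p q : ℕ) : Game ((i : Fin n) × Fin (b i)) where
  p := p
  q := q
  targets := Set.range (box b)

/-- The uniform misère box game `mBox(n × k, (p, q))`: there are `n` boxes, all of size `k`. -/
def mBoxUniform (n k p q : ℕ) : Game ((_ : Fin n) × Fin k) :=
  mBox (fun _ => k) p q

end AvoiderEnforcer

/-! Call a box live while Enforcer has claimed nothing in it, and an unclaimed element dead if its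
box is not live. Avoider loses as soon as a live box runs out of unclaimed elements.

If `d = gcd(p + q, l) > p` for some `l ≤ k`, Avoider reserves `d` elements in each live box and
claims elsewhere. When the surplus runs out, he breaks into one reserve. Dead elements then number
`p` modulo `d` whenever he is to move, since a round consumes `p + q ≡ 0`; as `p < d`, at least `p`
of them exist and he touches no other live element. If Enforcer enters the broken box, all reserves
are intact again (`AvoiderSafe`).

Conversely, Enforcer wins by induction on a bound `s` for the number of unclaimed elements in a live
box. He claims dead elements, and if they do not suffice he enters as few full boxes (those with `s`
unclaimed elements) as possible. Each entered box adds `s` dead elements, so modulo `s` their number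
drops by `p + q` per round. Because `gcd(p + q, s) ≤ p`, it falls below `p` after boundedly many
entries, and Avoider must claim in live boxes (`exists_rank`). With enough boxes, a potential shows
that many live boxes remain when the full ones are used up, and the bound `s - 1` applies
(`enforcerWins_of_potential`). -/

namespace AvoiderEnforcer

open Finset

set_option linter.unusedSectionVars false

/-! ### Positions, counted box by box -/

section Position

variable {X ι : Type*} [DecidableEq X] [DecidableEq ι]

/-- The number of elements of `U` in the box `i`, where `f` maps an element to its box. -/
def fiberCard (f : X → ι) (U : Finset X) (i : ι) : ℕ := #{x ∈ U | f x = i}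

/-- The number of elements of `U` that lie outside of the boxes in `L`. -/
def deadCard (f : X → ι) (U : Finset X) (L : Finset ι) : ℕ := #{x ∈ U | f x ∉ L}

variable {f : X → ι} {U M : Finset X} {L C : Finset ι} {i : ι} {p q : ℕ}

lemma sum_fiberCard (f : X → ι) (U : Finset X) (L : Finset ι) :
    ∑ i ∈ L, fiberCard f U i = #{x ∈ U | f x ∈ L} := by
  rw [card_eq_sum_card_fiberwise (f := f) (t := L) (by intro x hx; simpa using (by simpa using hx : x ∈ U ∧ f x ∈ L).2)]
  refine sum_congr rfl fun i hi => ?_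
  rw [fiberCard, filter_filter]
  congr 1
  ext x
  simp only [mem_filter]
  constructor
  · rintro ⟨h, rfl⟩; exact ⟨h, hi, rfl⟩
  · rintro ⟨h, _, rfl⟩; exact ⟨h, rfl⟩

lemma deadCard_add_sum (f : X → ι) (U : Finset X) (L : Finset ι) :
    deadCard f U L + ∑ i ∈ L, fiberCard f U i = #U := by
  rw [sum_fiberCard, deadCard, add_comm]
  exact card_filter_add_card_filter_not _

lemma fiberCard_le_card (f : X → ι) (U : Finset X) (i : ι) : fiberCard f U i ≤ #U :=
  card_filter_le _ _

lemma fiberCard_mono (f : X → ι) {U V : Finset X} (h : U ⊆ V) (i : ι) :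
    fiberCard f U i ≤ fiberCard f V i :=
  card_le_card (filter_subset_filter _ h)

lemma fiberCard_sdiff_of_forall_ne (h : ∀ x ∈ M, f x ≠ i) :
    fiberCard f (U \ M) i = fiberCard f U i := by
  unfold fiberCard
  congr 1
  ext x
  simp only [mem_filter, mem_sdiff]
  constructor
  · rintro ⟨⟨h1, _⟩, h2⟩; exact ⟨h1, h2⟩
  · rintro ⟨h1, h2⟩; exact ⟨⟨h1, fun hM => h x hM h2⟩, h2⟩

lemma fiberCard_sdiff_add (f : X → ι) (h : M ⊆ U) (i : ι) :
    fiberCard f (U \ M) i + fiberCard f M i = fiberCard f U i := by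
  unfold fiberCard
  rw [← card_union_of_disjoint, ← filter_union, sdiff_union_of_subset h]
  exact disjoint_filter_filter sdiff_disjoint

lemma forall_ne_of_fiberCard_eq_zero (h : fiberCard f U i = 0) : ∀ x ∈ U, f x ≠ i := by
  intro x hx hxi
  have := card_eq_zero.1 h
  exact notMem_empty x (this ▸ mem_filter.2 ⟨hx, hxi⟩)

lemma fiberCard_pos_iff : 0 < fiberCard f U i ↔ ∃ x ∈ U, f x = i := by
  simp [fiberCard, card_pos, Finset.Nonempty, mem_filter]

/-- A set of representatives of boxes that are not empty. -/
lemma exists_subset_card_eq_image_eq (h : ∀ i ∈ C, 0 < fiberCard f U i) :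
    ∃ R ⊆ U, #R = #C ∧ R.image f = C := by
  rcases C.eq_empty_or_nonempty with rfl | ⟨i₀, hi₀⟩
  · exact ⟨∅, by simp⟩
  have : Nonempty X := ⟨(fiberCard_pos_iff.1 (h i₀ hi₀)).choose⟩
  choose! g hg using fun i hi => fiberCard_pos_iff.1 (h i hi)
  refine ⟨C.image g, ?_, ?_, ?_⟩
  · intro x hx
    obtain ⟨i, hi, rfl⟩ := mem_image.1 hx
    exact (hg i hi).1
  · refine card_image_of_injOn fun i hi j hj hij => ?_
    rw [← (hg i hi).2, ← (hg j hj).2, hij]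
  · rw [image_image]
    ext i
    simp only [mem_image, Function.comp]
    constructor
    · rintro ⟨j, hj, rfl⟩; rwa [(hg j hj).2]
    · intro hi; exact ⟨i, hi, (hg i hi).2⟩

/-- The positions that are won for Enforcer in the box game with unclaimed elements `U`, if Enforcer
has claimed no element in exactly the boxes in `L`. -/
inductive EnforcerWins (p q : ℕ) (f : X → ι) : Player → Finset X → Finset ι → Prop
  | lost (P : Player) (U : Finset X) (L : Finset ι) (i : ι) :
      i ∈ L → (∀ x ∈ U, f x ≠ i) → EnforcerWins p q f P U L
  | avoider (U : Finset X) (L : Finset ι) : U.Nonempty →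
      (∀ M ⊆ U, #M = min p #U → EnforcerWins p q f .enforcer (U \ M) L) →
      EnforcerWins p q f .avoider U L
  | enforcer (U : Finset X) (L : Finset ι) (M : Finset X) : U.Nonempty → M ⊆ U →
      #M = min q #U → EnforcerWins p q f .avoider (U \ M) (L \ M.image f) →
      EnforcerWins p q f .enforcer U L

lemma EnforcerWins.exists_move (h : EnforcerWins p q f .enforcer U L) :
    ∃ M ⊆ U, #M = min q #U ∧ EnforcerWins p q f .avoider (U \ M) (L \ M.image f) := by
  cases h with
  | lost _ _ _ i hi hU =>
    obtain ⟨M, hM, hc⟩ := exists_subset_card_eq (min_le_right q #U)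
    refine ⟨M, hM, hc, .lost _ _ _ i ?_ fun x hx => hU x (mem_sdiff.1 hx).1⟩
    rw [mem_sdiff, mem_image]
    exact ⟨hi, fun ⟨x, hx, hxi⟩ => hU x (hM hx) hxi⟩
  | enforcer _ _ M _ hM hc hw => exact ⟨M, hM, hc, hw⟩

lemma EnforcerWins.avoider_move (h : EnforcerWins p q f .avoider U L) (hM : M ⊆ U)
    (hc : #M = min p #U) : EnforcerWins p q f .enforcer (U \ M) L := by
  cases h with
  | lost _ _ _ i hi hU => exact .lost _ _ _ i hi fun x hx => hU x (mem_sdiff.1 hx).1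
  | avoider _ _ _ hw => exact hw M hM hc

lemma EnforcerWins.exists_of_empty {P : Player} (h : EnforcerWins p q f P ∅ L) :
    L.Nonempty := by
  cases h with
  | lost _ _ _ i hi hU => exact ⟨i, hi⟩
  | avoider _ _ h => simp at h
  | enforcer _ _ _ h => simp at h

/-! ### Avoider's invariant -/

/-- The positions that Avoider maintains if `d` divides `p + q`: every box without an element of
Enforcer has at least `d` unclaimed elements, or exactly `d` except for one box `i`, and then the
unclaimed elements elsewhere are a multiple of `d` when Enforcer is to move. -/
def AvoiderSafe (q d : ℕ) (f : X → ι) (P : Player) (U : Finset X) (L : Finset ι) : Prop :=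
  (∀ i ∈ L, d ≤ fiberCard f U i) ∨
    ∃ i ∈ L, 0 < fiberCard f U i ∧ (∀ j ∈ L, j ≠ i → fiberCard f U j = d) ∧
      #U + (if P = .avoider then q else 0) ≡ fiberCard f U i [MOD d]

variable {d : ℕ}

lemma AvoiderSafe.fiberCard_pos {P : Player} (hd : 0 < d) (h : AvoiderSafe q d f P U L)
    (hi : i ∈ L) : 0 < fiberCard f U i := by
  rcases h with h | ⟨j, _, hj, h, _⟩
  · exact hd.trans_le (h i hi)
  · by_cases hij : i = j
    · rwa [hij]
    · rwa [h i hi hij]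

lemma AvoiderSafe.enforcer_move (hd : 0 < d) (h : AvoiderSafe q d f .enforcer U L) (hM : M ⊆ U)
    (hc : #M = min q #U) : AvoiderSafe q d f .avoider (U \ M) (L \ M.image f) := by
  have hsame : ∀ j ∈ L \ M.image f, fiberCard f (U \ M) j = fiberCard f U j := by
    intro j hj
    refine fiberCard_sdiff_of_forall_ne fun x hx hxj => ?_
    exact (mem_sdiff.1 hj).2 (mem_image.2 ⟨x, hx, hxj⟩)
  have hpos := fun i (hi : i ∈ L) => h.fiberCard_pos hd hi
  rcases h with h | ⟨i, hi, hi0, hj, hmod⟩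
  · left
    intro j hj
    rw [hsame j hj]
    exact h j (mem_sdiff.1 hj).1
  by_cases hiM : i ∈ M.image f
  · left
    intro j hjL
    rw [hsame j hjL]
    refine (hj j (mem_sdiff.1 hjL).1 ?_).ge
    rintro rfl
    exact (mem_sdiff.1 hjL).2 hiM
  · right
    have hiL : i ∈ L \ M.image f := mem_sdiff.2 ⟨hi, hiM⟩
    refine ⟨i, hiL, by rwa [hsame i hiL], fun j hjL hne => ?_, ?_⟩
    · rw [hsame j hjL]; exact hj j (mem_sdiff.1 hjL).1 hne
    · rw [hsame i hiL]
      have hcs := card_sdiff_add_card_eq_card hM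
      rcases le_total q #U with hq | hq
      · rw [min_eq_left hq] at hc
        simpa [← hc, hcs] using hmod
      -- A truncated move takes every unclaimed element, so it would have entered `i`.
      · rw [min_eq_right hq] at hc
        have := eq_of_subset_of_card_le hM hc.ge
        obtain ⟨x, hx, rfl⟩ := fiberCard_pos_iff.1 (hpos i hi)
        exact absurd (mem_image_of_mem f (this ▸ hx)) hiM

/-- With all reserves intact, claim outside them, breaking one only if necessary; with one already
broken, the congruence guarantees `p` dead elements. -/
lemma AvoiderSafe.exists_move (hpd : p < d) (hd : d ∣ p + q)
    (h : AvoiderSafe q d f .avoider U L) :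
    ∃ M ⊆ U, #M = min p #U ∧ AvoiderSafe q d f .enforcer (U \ M) L := by
  rcases L.eq_empty_or_nonempty with rfl | ⟨i₀, hi₀⟩
  · obtain ⟨M, hM, hc⟩ := exists_subset_card_eq (min_le_right p #U)
    exact ⟨M, hM, hc, .inl (by simp)⟩
  rcases h with h | ⟨i, hi, hi0, hj, hmod⟩
  · have hpU : p ≤ #U := hpd.le.trans ((h i₀ hi₀).trans (fiberCard_le_card f U i₀))
    rw [min_eq_left hpU]
    choose! B hBsub hBcard using fun i hi => exists_subset_card_eq (h i hi)
    have hB : ∀ i ∈ L, ∀ x ∈ B i, x ∈ U ∧ f x = i := fun i hi x hx => by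
      simpa using hBsub i hi hx
    set K := L.biUnion B with hK
    have hKU : K ⊆ U := fun x hx => by
      obtain ⟨i, hi, hx⟩ := mem_biUnion.1 hx
      exact (hB i hi x hx).1
    have hfib : ∀ i ∈ L, {x ∈ K | f x = i} = B i := by
      intro i hi
      ext x
      simp only [hK, mem_filter, mem_biUnion]
      constructor
      · rintro ⟨⟨j, hjL, hx⟩, rfl⟩
        rwa [(hB j hjL x hx).2]
      · intro hx; exact ⟨⟨i, hi, hx⟩, (hB i hi x hx).2⟩
    have hKf : ∀ i ∈ L, fiberCard f K i = d := fun i hi => by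
      rw [fiberCard, hfib i hi, hBcard i hi]
    rcases le_total p #(U \ K) with hle | hle
    · obtain ⟨M, hM, hc⟩ := exists_subset_card_eq hle
      refine ⟨M, hM.trans sdiff_subset, hc, .inl fun i hi => ?_⟩
      rw [← hKf i hi]
      refine fiberCard_mono f (fun x hx => mem_sdiff.2 ⟨hKU hx, fun hxM => ?_⟩) i
      exact (mem_sdiff.1 (hM hxM)).2 hx
    -- At most `p` elements lie outside the reserves: take them all and the rest from `B i₀`, which
    -- is not exhausted because `p < d`.
    · have hsub : U \ K ⊆ (U \ K) ∪ B i₀ := subset_union_left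
      have hp : p ≤ #((U \ K) ∪ B i₀) := by
        refine hpd.le.trans ?_
        rw [← hBcard i₀ hi₀]
        exact card_le_card subset_union_right
      obtain ⟨M, hM1, hM2, hc⟩ := exists_subsuperset_card_eq hsub hle hp
      have hMU : M ⊆ U := hM2.trans (union_subset sdiff_subset fun x hx => (hB i₀ hi₀ x hx).1)
      have hother : ∀ j ∈ L, j ≠ i₀ → fiberCard f (U \ M) j = d := by
        intro j hjL hne
        rw [← hKf j hjL, fiberCard, fiberCard]
        congr 1
        ext x
        simp only [mem_filter, mem_sdiff]
        constructor
        · rintro ⟨⟨hxU, hxM⟩, rfl⟩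
          exact ⟨by_contra fun hxK => hxM (hM1 (mem_sdiff.2 ⟨hxU, hxK⟩)), rfl⟩
        · rintro ⟨hxK, rfl⟩
          refine ⟨⟨hKU hxK, fun hxM => ?_⟩, rfl⟩
          rcases mem_union.1 (hM2 hxM) with h' | h'
          · exact (mem_sdiff.1 h').2 hxK
          · exact hne (hB i₀ hi₀ x h').2
      refine ⟨M, hMU, hc, .inr ⟨i₀, hi₀, ?_, hother, ?_⟩⟩
      · have h1 := fiberCard_sdiff_add f hMU i₀
        have h2 := fiberCard_le_card f M i₀
        have h3 := h i₀ hi₀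
        omega
      · have h1 := deadCard_add_sum f (U \ M) L
        have h2 : deadCard f (U \ M) L = 0 := by
          rw [deadCard, card_eq_zero, filter_eq_empty_iff]
          intro x hx
          rw [not_not]
          have hxK : x ∈ K := by_contra fun hxK =>
            (mem_sdiff.1 hx).2 (hM1 (mem_sdiff.2 ⟨(mem_sdiff.1 hx).1, hxK⟩))
          obtain ⟨j, hj, hxj⟩ := mem_biUnion.1 hxK
          rwa [(hB j hj x hxj).2]
        rw [← add_sum_erase L _ hi₀, sum_congr rfl (fun j hj =>
          hother j (mem_of_mem_erase hj) (ne_of_mem_erase hj)), sum_const, smul_eq_mul, h2] at h1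
        rw [← h1]
        simp [Nat.ModEq]
  · have h1 := deadCard_add_sum f U L
    rw [← add_sum_erase L _ hi, sum_congr rfl (fun j h' =>
      hj j (mem_of_mem_erase h') (ne_of_mem_erase h')), sum_const, smul_eq_mul] at h1
    -- Otherwise `d` divides both `p + q` and `deadCard f U L + q`, hence their difference, which
    -- lies strictly between `0` and `d`.
    have hpD : p ≤ deadCard f U L := by
      by_contra! hlt
      simp only [if_true] at hmod
      have h2 : deadCard f U L + q ≡ 0 [MOD d] := by
        refine Nat.ModEq.add_right_cancel' (fiberCard f U i) ?_
        rw [zero_add]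
        refine Nat.ModEq.trans ?_ hmod
        rw [← h1]
        simp only [Nat.ModEq]
        rw [show deadCard f U L + (fiberCard f U i + #(L.erase i) * d) + q
          = deadCard f U L + q + fiberCard f U i + #(L.erase i) * d by ring]
        simp
      have h3 := (Nat.modEq_zero_iff_dvd.1 h2)
      have h4 := Nat.le_of_dvd (by omega) ((Nat.dvd_sub hd h3))
      omega
    obtain ⟨M, hM, hc⟩ := exists_subset_card_eq hpD
    have hMU : M ⊆ U := hM.trans (filter_subset _ _)
    have hsame : ∀ j ∈ L, fiberCard f (U \ M) j = fiberCard f U j := fun j hjL =>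
      fiberCard_sdiff_of_forall_ne fun x hx hxj => (mem_filter.1 (hM hx)).2 (hxj ▸ hjL)
    refine ⟨M, hMU, ?_, .inr ⟨i, hi, ?_, fun j hjL hne => ?_, ?_⟩⟩
    · rw [hc, min_eq_left]; omega
    · rwa [hsame i hi]
    · rw [hsame j hjL]; exact hj j hjL hne
    · rw [hsame i hi]
      refine Nat.ModEq.trans ?_ hmod
      have hcs := card_sdiff_add_card_eq_card hMU
      rw [← hcs, hc]
      simp only [reduceCtorEq, if_false, if_true, add_zero]
      rw [add_assoc]
      simpa using (Nat.ModEq.refl #(U \ M)).add (Nat.modEq_zero_iff_dvd.2 hd).symm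

end Position

/-! ### Arithmetic of the dead elements -/

/-- A bound `r D` for the number of rounds until fewer than `p` elements remain, if `D` elements
decrease by `m` per round and are replenished in portions of `s`. -/
lemma exists_rank {p m s : ℕ} (hs : 0 < s) (hg : Nat.gcd m s ≤ p) :
    ∃ r : ℕ → ℕ, (∀ D, r D ≤ s) ∧ ∀ D D' c, p ≤ D → D' + m = D + s * c →
      (c = 0 → r D' ≤ r D) ∧ (D' < s → r D' < r D) := by
  classical
  -- Take for `x` the remainder of `D` modulo `gcd m s ≤ p`; the rest of `D` is a multiple of the
  -- gcd, hence of `m` modulo `s`.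
  have hex : ∀ D, ∃ j < s, ∃ x < p, x + j * m ≡ D [MOD s] := by
    intro D
    have hg0 : 0 < Nat.gcd m s := Nat.gcd_pos_of_pos_right m hs
    obtain ⟨y, hy⟩ : ∃ y : ℤ, (m : ℤ) * y ≡ Nat.gcd m s [ZMOD s] := by
      refine ⟨Nat.gcdA m s, ?_⟩
      rw [Nat.gcd_eq_gcd_ab]
      simp [Int.ModEq]
    let z : ℤ := y * (D / Nat.gcd m s : ℕ)
    have hs' : (s : ℤ) ≠ 0 := by exact_mod_cast hs.ne'
    have hz := Int.emod_nonneg z hs'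
    have hz' := Int.emod_lt_of_pos z (by exact_mod_cast hs : (0 : ℤ) < s)
    refine ⟨(z % s).toNat, by omega, D % Nat.gcd m s, (Nat.mod_lt _ hg0).trans_le hg, ?_⟩
    rw [← Int.natCast_modEq_iff]
    push_cast
    rw [Int.toNat_of_nonneg hz]
    have h1 : (z % s) * m ≡ Nat.gcd m s * (D / Nat.gcd m s : ℕ) [ZMOD s] := by
      refine ((Int.mod_modEq z s).mul_right m).trans ?_
      have := hy.mul_right (D / Nat.gcd m s : ℕ)
      rwa [show z * m = m * y * (D / Nat.gcd m s : ℕ) by simp only [z]; ring]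
    have h2 := h1.add_left ((D % Nat.gcd m s : ℕ) : ℤ)
    have h3 : ((D % Nat.gcd m s : ℕ) : ℤ) + Nat.gcd m s * (D / Nat.gcd m s : ℕ) = D := by
      exact_mod_cast Nat.mod_add_div D _
    rw [h3] at h2
    exact_mod_cast h2
  have hex' : ∀ D, ∃ j, ∃ x < p, x + j * m ≡ D [MOD s] := fun D => by
    obtain ⟨j, _, h⟩ := hex D
    exact ⟨j, h⟩
  have hlt : ∀ D, Nat.find (hex' D) < s := fun D => by
    obtain ⟨j, hj, h⟩ := hex D
    exact (Nat.find_min' (hex' D) h).trans_lt hj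
  -- Below `s` the rank is the least such `j`; the value `s` for larger `D` exceeds all of these.
  refine ⟨fun D => if D < s then Nat.find (hex' D) else s, fun D => ?_, fun D D' c hD h => ?_⟩
  · dsimp only
    split_ifs
    · exact (hlt D).le
    · exact le_rfl
  · have key : D < s → D' < s → Nat.find (hex' D') < Nat.find (hex' D) := by
      intro hDs _
      obtain ⟨x, hx, hmod⟩ := Nat.find_spec (hex' D)
      set j := Nat.find (hex' D)
      -- Rank `0` with `D < s` would force `D = x < p`.
      have hj : j ≠ 0 := by
        intro h0
        rw [h0, zero_mul, add_zero, Nat.ModEq, Nat.mod_eq_of_lt hDs] at hmod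
        have := Nat.mod_le x s
        omega
      obtain ⟨j', hj'⟩ := Nat.exists_eq_succ_of_ne_zero hj
      rw [hj', Nat.lt_succ_iff]
      refine Nat.find_min' _ ⟨x, hx, ?_⟩
      refine Nat.ModEq.add_right_cancel' m ?_
      rw [h, show x + j' * m + m = x + j * m by rw [hj']; simp only [Nat.succ_eq_add_one]; ring]
      refine hmod.trans ?_
      simp [Nat.ModEq]
    dsimp only
    constructor
    · rintro rfl
      by_cases hDs : D < s
      · have hDs' : D' < s := by omega
        rw [if_pos hDs, if_pos hDs']
        exact (key hDs hDs').le
      · rw [if_neg hDs]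
        split_ifs
        · exact (hlt _).le
        · exact le_rfl
    · intro hDs'
      rw [if_pos hDs']
      split_ifs with hDs
      · exact key hDs hDs'
      · exact hlt _

/-- `c` portions of size `s` are the fewest that bring `D` elements up to at least `q`. -/
lemma exists_replenishment {s : ℕ} (hs : 0 < s) (q D : ℕ) : ∃ c, c ≤ q ∧ q ≤ D + s * c ∧
    (q ≤ D → c = 0) ∧ (D < q → D + s * c < q + s) := by
  rcases le_or_gt q D with h | h
  · exact ⟨0, by omega, by omega, fun _ => rfl, by omega⟩
  · obtain ⟨y, hy⟩ : ∃ y, y = q - D := ⟨_, rfl⟩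
    have h1 := Nat.div_add_mod (y + s - 1) s
    have h2 := Nat.mod_lt (y + s - 1) hs
    have h3 : (y + s - 1) / s < y + 1 := by
      rw [Nat.div_lt_iff_lt_mul hs, add_mul, one_mul]
      have := Nat.le_mul_of_pos_right y hs
      omega
    exact ⟨(y + s - 1) / s, by omega, by omega, by omega, fun _ => by omega⟩

/-! ### Enforcer's potential argument -/

section Position

variable {X ι : Type*} [DecidableEq X] [DecidableEq ι]
variable {f : X → ι} {U M : Finset X} {L C : Finset ι} {i : ι} {p q s : ℕ}

lemma card_le_card_sdiff_image_add (f : X → ι) (L : Finset ι) (M : Finset X) :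
    #L ≤ #(L \ M.image f) + #M := by
  have h1 := le_card_sdiff (M.image f) L
  have h2 : #(M.image f) ≤ #M := card_image_le
  omega

lemma mul_card_eq_sum_sub_add_sum (h : ∀ i ∈ L, fiberCard f U i ≤ s) :
    s * #L = ∑ i ∈ L, (s - fiberCard f U i) + ∑ i ∈ L, fiberCard f U i := by
  rw [← sum_add_distrib, sum_congr rfl (fun i hi => Nat.sub_add_cancel (h i hi)), sum_const,
    smul_eq_mul, mul_comm]

/-- Enforcer claims `q` elements such that, among the boxes in `L`, he enters exactly those
in `C`. -/
lemma exists_move_image_inter_eq (hCL : C ⊆ L) (hs : 0 < s) (hC : ∀ i ∈ C, fiberCard f U i = s)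
    (hCq : #C ≤ q) (hq : q ≤ deadCard f U L + s * #C) :
    ∃ M ⊆ U, #M = q ∧ L \ M.image f = L \ C ∧
      (∀ i ∈ L \ C, fiberCard f (U \ M) i = fiberCard f U i) ∧
      deadCard f (U \ M) (L \ C) + q = deadCard f U L + s * #C := by
  obtain ⟨R, hRU, hRC, hRi⟩ := exists_subset_card_eq_image_eq (f := f) (U := U) (C := C)
    fun i hi => by rw [hC i hi]; exact hs
  set T := {x ∈ U | f x ∉ L \ C} with hT
  have hRT : R ⊆ T := fun x hx => mem_filter.2 ⟨hRU hx, fun h =>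
    (mem_sdiff.1 h).2 (hRi ▸ mem_image_of_mem f hx)⟩
  have hTcard : #T = deadCard f U L + s * #C := by
    have h1 := deadCard_add_sum f U L
    have h2 : #T + _ = _ := deadCard_add_sum f U (L \ C)
    have h3 := sum_sdiff (f := fiberCard f U) hCL
    rw [sum_congr rfl hC, sum_const, smul_eq_mul, mul_comm] at h3
    omega
  obtain ⟨M, hRM, hMT, hc⟩ := exists_subsuperset_card_eq hRT (hRC.trans_le hCq)
    (hTcard ▸ hq)
  have hMU : M ⊆ U := hMT.trans (filter_subset _ _)
  have hsame : ∀ i ∈ L \ C, ∀ x ∈ M, f x ≠ i := by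
    rintro i hi x hx rfl
    exact (mem_filter.1 (hMT hx)).2 hi
  refine ⟨M, hMU, hc, ?_, fun i hi => fiberCard_sdiff_of_forall_ne (hsame i hi), ?_⟩
  · ext i
    rw [mem_sdiff, mem_sdiff]
    refine and_congr_right fun hi => not_congr ⟨fun h => ?_, fun h => ?_⟩
    · obtain ⟨x, hx, rfl⟩ := mem_image.1 h
      by_contra hn
      exact hsame _ (mem_sdiff.2 ⟨hi, hn⟩) x hx rfl
    · rw [← hRi] at h
      exact image_subset_image hRM h
  · rw [← hTcard, ← hc]
    have : {x ∈ U \ M | f x ∉ L \ C} = T \ M := by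
      ext x
      simp only [hT, mem_filter, mem_sdiff]
      tauto
    rw [deadCard, this, card_sdiff_add_card_eq_card hMT]

set_option maxHeartbeats 800000 in
-- The potential is the number of full boxes, plus `K` times the total deficiency of live boxes,
-- minus `q * r D`. Enforcer's replies keep it above the threshold as long as at least `q` full
-- boxes are left for him to enter.
lemma enforcerWins_of_potential {N : ℕ} (hp : 0 < p) (hq : 0 < q) (hs : 0 < s)
    (hN : ∀ (U : Finset X) (L : Finset ι), (∀ i ∈ L, fiberCard f U i < s) → N ≤ #L →
      EnforcerWins p q f .avoider U L)
    {r : ℕ → ℕ} (hr : ∀ D, r D ≤ s)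
    (hr' : ∀ D D' c, p ≤ D → D' + (p + q) = D + s * c →
      (c = 0 → r D' ≤ r D) ∧ (D' < s → r D' < r D)) {K : ℕ} (hK : K = 1 + q + q * s)
    (U : Finset X) (L : Finset ι) (hL : ∀ i ∈ L, fiberCard f U i ≤ s)
    (hpot : q + K * (s * (N + q)) + q * r (deadCard f U L) ≤
      #{i ∈ L | fiberCard f U i = s} + K * ∑ i ∈ L, (s - fiberCard f U i)) :
    EnforcerWins p q f .avoider U L := by
  induction hn : #U using Nat.strong_induction_on generalizing U L with
  | _ n ih =>
  by_cases hU0 : ∃ i ∈ L, fiberCard f U i = 0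
  · obtain ⟨i, hi, h0⟩ := hU0
    exact .lost _ _ _ i hi (forall_ne_of_fiberCard_eq_zero h0)
  push Not at hU0
  have hUne : U.Nonempty := by
    rcases L.eq_empty_or_nonempty with rfl | ⟨i, hi⟩
    · simp at hpot
      omega
    · obtain ⟨x, hx, _⟩ := fiberCard_pos_iff.1 (Nat.pos_of_ne_zero (hU0 i hi))
      exact ⟨x, hx⟩
  refine .avoider U L hUne fun M hM hc => ?_
  by_cases hU1 : ∃ i ∈ L, fiberCard f (U \ M) i = 0
  · obtain ⟨i, hi, h0⟩ := hU1
    exact .lost _ _ _ i hi (forall_ne_of_fiberCard_eq_zero h0)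
  push Not at hU1
  have hpos1 : ∀ i ∈ L, 0 < fiberCard f (U \ M) i := fun i hi => Nat.pos_of_ne_zero (hU1 i hi)
  have hL1 : ∀ i ∈ L, fiberCard f (U \ M) i ≤ s := fun i hi =>
    (fiberCard_mono f sdiff_subset i).trans (hL i hi)
  have hUM := card_sdiff_add_card_eq_card hM
  have hd0 := deadCard_add_sum f U L
  have hd1 := deadCard_add_sum f (U \ M) L
  have hv0 := mul_card_eq_sum_sub_add_sum hL
  have hv1 := mul_card_eq_sum_sub_add_sum hL1
  have hcardL : #L ≤ #(U \ M) := by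
    rw [← hd1, card_eq_sum_ones]
    exact (sum_le_sum hpos1).trans (Nat.le_add_left _ _)
  obtain ⟨t, ht⟩ : ∃ t, t = ∑ i ∈ L, fiberCard f M i := ⟨_, rfl⟩
  have hsum : ∑ i ∈ L, fiberCard f (U \ M) i + t = ∑ i ∈ L, fiberCard f U i := by
    rw [ht, ← sum_add_distrib]
    exact sum_congr rfl fun i _ => fiberCard_sdiff_add f hM i
  have ha : #{i ∈ L | fiberCard f U i = s} ≤ #{i ∈ L | fiberCard f (U \ M) i = s} + t := by
    rw [ht, sum_fiberCard]
    refine le_trans ?_ (Nat.add_le_add_left (card_image_le (f := f)) _)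
    refine le_trans (card_le_card fun i hi => ?_) (card_union_le _ _)
    rw [mem_filter] at hi
    by_cases h : ∃ x ∈ M, f x = i
    · obtain ⟨x, hx, rfl⟩ := h
      exact mem_union_right _ (mem_image_of_mem f (mem_filter.2 ⟨hx, hi.1⟩))
    · push Not at h
      refine mem_union_left _ (mem_filter.2 ⟨hi.1, ?_⟩)
      rw [fiberCard_sdiff_of_forall_ne h, hi.2]
  have htM : deadCard f (U \ M) L + #M = deadCard f U L + t := by omega
  set a := #{i ∈ L | fiberCard f U i = s}
  set v := ∑ i ∈ L, (s - fiberCard f U i)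
  set D := deadCard f U L
  set D1 := deadCard f (U \ M) L with hD1
  set v1 := ∑ i ∈ L, (s - fiberCard f (U \ M) i) with hv1'
  set a1 := #{i ∈ L | fiberCard f (U \ M) i = s} with ha1
  have hvt : v1 = v + t := by omega
  -- Each element claimed in a live box gains `K`: `1` pays for the full box it may spoil, `q` for
  -- the boxes Enforcer enters in this round, `q * s` for a reset of the rank.
  have hKt : K * v1 = K * v + t + (q + q * s) * t := by rw [hvt, hK]; ring
  -- With fewer than `q` full boxes the deficiency must be large, so there are at least `N + q` live
  -- boxes; Enforcer enters all full ones and at least `N` smaller ones survive.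
  rcases lt_or_ge a1 q with haq | haq
  · have h1 : K * (s * (N + q)) ≤ K * v1 := by
      have : 0 ≤ (q + q * s) * t := Nat.zero_le _
      have : 0 ≤ q * r D := Nat.zero_le _
      omega
    have h2 : s * (N + q) ≤ s * #L :=
      (Nat.le_of_mul_le_mul_left h1 (by omega)).trans (by omega)
    have h3 : N + q ≤ #L := Nat.le_of_mul_le_mul_left h2 hs
    obtain ⟨R, hRU, hRC, hRi⟩ := exists_subset_card_eq_image_eq (f := f) (U := U \ M)
      (C := {i ∈ L | fiberCard f (U \ M) i = s}) fun i hi => hpos1 i (mem_filter.1 hi).1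
    obtain ⟨M', hRM, hMU, hc'⟩ := exists_subsuperset_card_eq (n := q) hRU (by omega) (by omega)
    refine .enforcer _ _ M' (card_pos.1 (by omega)) hMU ?_ (hN _ _ (fun i hi => ?_) ?_)
    · rw [hc', min_eq_left]; omega
    · obtain ⟨hiL, hiM⟩ := mem_sdiff.1 hi
      refine (fiberCard_mono f sdiff_subset i).trans_lt (lt_of_le_of_ne (hL1 i hiL) fun h => ?_)
      refine hiM (image_subset_image hRM ?_)
      rw [hRi]
      exact mem_filter.2 ⟨hiL, h⟩
    · have := card_le_card_sdiff_image_add f L M'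
      omega
  · have hMp : #M = p := by
      have : 0 < #(U \ M) := by
        have : a1 ≤ #L := card_filter_le _ _
        omega
      omega
    obtain ⟨c, hcq, hqc, hc0, hcs⟩ : ∃ c, c ≤ q ∧ q ≤ D1 + s * c ∧ (q ≤ D1 → c = 0) ∧
        (D1 < q → D1 + s * c < q + s) := exists_replenishment hs q D1
    obtain ⟨C, hCsub, hCc⟩ := exists_subset_card_eq (hcq.trans haq)
    have hCL : C ⊆ L := hCsub.trans (filter_subset _ _)
    have hCs : ∀ i ∈ C, fiberCard f (U \ M) i = s := fun i hi => (mem_filter.1 (hCsub hi)).2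
    obtain ⟨M', hM'U, hM'c, hLC, hsame, hD2⟩ := exists_move_image_inter_eq (q := q) hCL hs hCs
      (by omega) (by rw [hCc]; exact hqc)
    have hqU : q ≤ #(U \ M) := hM'c ▸ card_le_card hM'U
    refine .enforcer _ _ M' (card_pos.1 (by omega)) hM'U (by rw [hM'c, min_eq_left hqU]) ?_
    rw [hLC]
    refine ih _ ?_ _ _ (fun i hi => ?_) ?_ rfl
    · have := card_sdiff_add_card_eq_card hM'U
      omega
    · rw [hsame i hi]
      exact hL1 i (mem_sdiff.1 hi).1
    · have hv2 : ∑ i ∈ L \ C, (s - fiberCard f ((U \ M) \ M') i) = v1 := by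
        rw [sum_congr rfl (fun i hi => by rw [hsame i hi]), hv1', ← sum_sdiff hCL,
          sum_eq_zero (s := C) (fun i hi => by rw [hCs i hi, Nat.sub_self]), add_zero]
      have ha2 : #{i ∈ L \ C | fiberCard f ((U \ M) \ M') i = s} + c = a1 := by
        rw [ha1, ← hCc, ← card_sdiff_add_card_eq_card hCsub]
        congr 2
        ext i
        simp only [mem_filter, mem_sdiff]
        constructor
        · rintro ⟨⟨h1, h2⟩, h3⟩
          rw [hsame i (mem_sdiff.2 ⟨h1, h2⟩)] at h3
          exact ⟨⟨h1, h3⟩, h2⟩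
        · rintro ⟨⟨h1, h3⟩, h2⟩
          exact ⟨⟨h1, h2⟩, by rw [hsame i (mem_sdiff.2 ⟨h1, h2⟩), h3]⟩
      rw [hv2]
      rw [hCc, ← hD1] at hD2
      set D2 := deadCard f ((U \ M) \ M') (L \ C)
      rcases Nat.eq_zero_or_pos t with ht0 | htpos
      · have hDp : p ≤ D := by omega
        obtain ⟨hr0, hr1⟩ := hr' D D2 c hDp (by omega)
        -- If Avoider claimed only dead elements, the drop in rank pays for the `c ≤ q` entered
        -- boxes; by minimality of `c`, replenishing leaves fewer than `s` dead elements.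
        have hqr : q * r D2 + c ≤ q * r D := by
          rcases le_or_gt q D1 with h | h
          · rw [hc0 h, add_zero]
            exact Nat.mul_le_mul_left q (hr0 (hc0 h))
          · have := Nat.mul_le_mul_left q (hr1 (by have := hcs h; omega))
            rw [Nat.succ_eq_add_one, mul_add] at this
            omega
        rw [ht0] at hKt ha
        omega
      · have h1 : q * r D2 ≤ q * s := Nat.mul_le_mul_left q (hr D2)
        have h2 : q + q * s ≤ (q + q * s) * t := Nat.le_mul_of_pos_right _ htpos
        have : 0 ≤ q * r D := Nat.zero_le _
        omega

/-- Enforcer wins if there are sufficiently many boxes that he has not entered. -/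
lemma exists_enforcerWins (hp : 0 < p) (hq : 0 < q) (k : ℕ)
    (hg : ∀ l, 1 ≤ l → l ≤ k → Nat.gcd (p + q) l ≤ p) :
    ∃ N : ℕ, ∀ (X ι : Type) [DecidableEq X] [DecidableEq ι] (f : X → ι) (U : Finset X)
      (L : Finset ι), (∀ i ∈ L, fiberCard f U i ≤ k) → N ≤ #L →
      EnforcerWins p q f .avoider U L := by
  induction k with
  | zero =>
    refine ⟨1, fun X ι _ _ f U L hL hc => ?_⟩
    obtain ⟨i, hi⟩ := card_pos.1 hc
    exact .lost _ _ _ i hi (forall_ne_of_fiberCard_eq_zero (Nat.le_zero.1 (hL i hi)))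
  | succ k ih =>
    obtain ⟨N, hN⟩ := ih fun l h1 h2 => hg l h1 (by omega)
    obtain ⟨r, hr, hr'⟩ := exists_rank (Nat.succ_pos k) (hg (k + 1) (by omega) le_rfl)
    refine ⟨q + (1 + q + q * (k + 1)) * ((k + 1) * (N + q)) + q * (k + 1),
      fun X ι _ _ f U L hL hc => ?_⟩
    refine enforcerWins_of_potential hp hq (Nat.succ_pos k) (fun U L h => hN X ι f U L
      fun i hi => Nat.lt_succ_iff.1 (h i hi)) hr hr' rfl U L hL ?_
    refine le_trans (Nat.add_le_add_left (Nat.mul_le_mul_left q (hr _)) _) (hc.trans ?_)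
    -- A box is full or has positive deficiency, so many boxes alone give a large potential.
    have h1 : #L ≤ #{i ∈ L | fiberCard f U i = k + 1} +
        ∑ i ∈ L, (k + 1 - fiberCard f U i) := by
      rw [card_filter, ← sum_add_distrib, card_eq_sum_ones]
      refine sum_le_sum fun i hi => ?_
      have := hL i hi
      split_ifs <;> omega
    refine h1.trans (Nat.add_le_add_left (Nat.le_mul_of_pos_left _ (by omega)) _)

end Position

/-! ### From positions to histories and strategies -/

namespace History

variable {X : Type*} [DecidableEq X]

lemma unclaimed_cons [Fintype X] (first : Player) (M : Finset X) (h : History X) :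
    unclaimed first (M :: h) = unclaimed first h \ M := by
  ext x
  cases ht : turn first h <;>
    simp only [unclaimed, claimedBy, ht, reduceCtorEq, if_true, if_false, mem_sdiff, mem_union,
      mem_univ, true_and] <;> tauto

lemma claimedBy_cons_of_eq {first P : Player} {M : Finset X} {h : History X}
    (ht : turn first h = P) : claimedBy first P (M :: h) = M ∪ claimedBy first P h := by
  rw [claimedBy, if_pos ht]

lemma claimedBy_cons_of_ne {first P : Player} {M : Finset X} {h : History X}
    (ht : turn first h ≠ P) : claimedBy first P (M :: h) = claimedBy first P h := by
  rw [claimedBy, if_neg ht]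

/-- The boxes in which Enforcer has not claimed any element. -/
def liveBoxes {n : ℕ} {b : Fin n → ℕ} (first : Player) (h : History ((i : Fin n) × Fin (b i))) :
    Finset (Fin n) :=
  univ \ (claimedBy first .enforcer h).image Sigma.fst

variable {n : ℕ} {b : Fin n → ℕ} {first : Player} {h : History ((i : Fin n) × Fin (b i))}
  {M : Finset ((i : Fin n) × Fin (b i))}

lemma liveBoxes_cons_of_avoider (ht : turn first h = .avoider) :
    liveBoxes first (M :: h) = liveBoxes first h := by
  rw [liveBoxes, claimedBy_cons_of_ne (by rw [ht]; decide), liveBoxes]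

lemma liveBoxes_cons_of_enforcer (ht : turn first h = .enforcer) :
    liveBoxes first (M :: h) = liveBoxes first h \ M.image Sigma.fst := by
  rw [liveBoxes, claimedBy_cons_of_eq ht, liveBoxes, image_union]
  ext i
  simp only [mem_sdiff, mem_univ, true_and, mem_union]
  tauto

lemma turn_cons_of_avoider (ht : turn first h = .avoider) : turn first (M :: h) = .enforcer := by
  rw [turn, ht, Player.other]

lemma turn_cons_of_enforcer (ht : turn first h = .enforcer) : turn first (M :: h) = .avoider := by
  rw [turn, ht, Player.other]

lemma disjoint_claimedBy_cons (hM : M ⊆ unclaimed first h)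
    (hd : Disjoint (claimedBy first .avoider h) (claimedBy first .enforcer h)) :
    Disjoint (claimedBy first .avoider (M :: h)) (claimedBy first .enforcer (M :: h)) := by
  have h1 : Disjoint M (claimedBy first .avoider h) := by
    refine disjoint_left.2 fun x hx h' => ?_
    exact (mem_sdiff.1 (hM hx)).2 (mem_union_left _ h')
  have h2 : Disjoint M (claimedBy first .enforcer h) := by
    refine disjoint_left.2 fun x hx h' => ?_
    exact (mem_sdiff.1 (hM hx)).2 (mem_union_right _ h')
  cases ht : turn first h
  · rw [claimedBy_cons_of_eq ht, claimedBy_cons_of_ne (by rw [ht]; decide)]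
    exact disjoint_union_left.2 ⟨h2, hd⟩
  · rw [claimedBy_cons_of_eq ht, claimedBy_cons_of_ne (by rw [ht]; decide)]
    exact disjoint_union_right.2 ⟨h1.symm, hd⟩

end History

open History

variable {n p q : ℕ} {b : Fin n → ℕ} {first : Player}

lemma fiberCard_univ (b : Fin n → ℕ) (i : Fin n) :
    fiberCard (Sigma.fst : (i : Fin n) × Fin (b i) → Fin n) univ i = b i := by
  rw [fiberCard]
  have : ({x | x.1 = i} : Finset ((i : Fin n) × Fin (b i))) = univ.map (.sigmaMk i) := by
    ext ⟨j, y⟩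
    simp only [mem_filter, mem_univ, true_and, mem_map]
    constructor
    · rintro rfl; exact ⟨y, rfl⟩
    · rintro ⟨z, hz⟩
      exact (congrArg Sigma.fst hz).symm
  rw [this, card_map, card_univ, Fintype.card_fin]

/-- The strategy chooses any move that keeps `EnforcerWins`. In a finished game this leaves a live
box, all of whose elements are then Avoider's. -/
lemma enforcerHasWinningStrategy_of_enforcerWins
    (h0 : EnforcerWins p q (Sigma.fst : (i : Fin n) × Fin (b i) → Fin n) first univ univ) :
    (mBox b p q).EnforcerHasWinningStrategy first := by
  classical
  let f : (i : Fin n) × Fin (b i) → Fin n := Sigma.fst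
  let good (h : History ((i : Fin n) × Fin (b i))) (M : Finset ((i : Fin n) × Fin (b i))) : Prop :=
    M ⊆ h.unclaimed first ∧ #M = min q #(h.unclaimed first) ∧
      EnforcerWins p q f .avoider (h.unclaimed first \ M) (h.liveBoxes first \ M.image f)
  let σ (h : History ((i : Fin n) × Fin (b i))) : Finset ((i : Fin n) × Fin (b i)) :=
    if hg : ∃ M, good h M then hg.choose else ∅
  have hσ : ∀ h, EnforcerWins p q f .enforcer (h.unclaimed first) (h.liveBoxes first) →
      good h (σ h) := by
    intro h hw
    have hg : ∃ M, good h M := hw.exists_move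
    simp only [σ, dif_pos hg]
    exact hg.choose_spec
  have hinv : ∀ h, (mBox b p q).Consistent first σ h →
      EnforcerWins p q f (h.turn first) (h.unclaimed first) (h.liveBoxes first) := by
    intro h hc
    induction hc with
    | start => simpa [turn, unclaimed, claimedBy, liveBoxes] using h0
    | avoiderMove h M _ _ ht hM ih =>
      rw [turn_cons_of_avoider ht, unclaimed_cons, liveBoxes_cons_of_avoider ht]
      rw [ht] at ih
      refine ih.avoider_move hM.1 ?_
      rw [hM.2, ht]
      rfl
    | enforcerMove h _ _ ht ih =>
      rw [turn_cons_of_enforcer ht, unclaimed_cons, liveBoxes_cons_of_enforcer ht]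
      rw [ht] at ih
      exact (hσ h ih).2.2
  refine ⟨σ, fun h hc _ ht => ?_, fun h hc hover => ?_⟩
  · have hw := hinv h hc
    rw [ht] at hw
    obtain ⟨h1, h2, _⟩ := hσ h hw
    refine ⟨h1, ?_⟩
    rw [h2, ht]
    rfl
  · have hw := hinv h hc
    rw [Game.IsOver] at hover
    rw [hover] at hw
    obtain ⟨i, hi⟩ := hw.exists_of_empty
    refine ⟨box b i, ⟨i, rfl⟩, fun x hx => ?_⟩
    have hx1 : x.1 = i := (mem_filter.1 hx).2
    rw [unclaimed, sdiff_eq_empty_iff_subset] at hover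
    rcases mem_union.1 (hover (mem_univ x)) with h | h
    · exact h
    · exact absurd (hx1 ▸ mem_image_of_mem _ h) (mem_sdiff.1 hi).2

/-- Against a given `σ`, a consistent history that is safe for Avoider can always be extended to a
longer safe one, until a finished game contradicts that safe live boxes have unclaimed elements. -/
lemma not_enforcerHasWinningStrategy {d : ℕ} (hp : 0 < p) (hq : 0 < q) (hpd : p < d)
    (hd : d ∣ p + q) (hb : ∀ i, d ≤ b i) : ¬ (mBox b p q).EnforcerHasWinningStrategy first := by
  rintro ⟨σ, hlegal, hwin⟩
  let f : (i : Fin n) × Fin (b i) → Fin n := Sigma.fst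
  have hd0 : 0 < d := by omega
  suffices hmain : ∀ m : ℕ, ∀ h, #(h.unclaimed first) = m → (mBox b p q).Consistent first σ h →
      Disjoint (h.claimedBy first .avoider) (h.claimedBy first .enforcer) →
      AvoiderSafe q d f (h.turn first) (h.unclaimed first) (h.liveBoxes first) → False by
    refine hmain _ [] rfl .start (by simp [claimedBy]) (.inl fun i _ => ?_)
    have : unclaimed first ([] : History ((i : Fin n) × Fin (b i))) = univ := by
      simp [unclaimed, claimedBy]
    rw [this, fiberCard_univ]
    exact hb i
  intro m
  induction m using Nat.strong_induction_on with
  | _ m ih =>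
  intro h hm hc hdisj hsafe
  by_cases hover : Game.IsOver first h
  · obtain ⟨_, ⟨i, rfl⟩, hi⟩ := hwin h hc hover
    have hlive : i ∈ h.liveBoxes first := by
      refine mem_sdiff.2 ⟨mem_univ _, fun h' => ?_⟩
      obtain ⟨x, hx, hxi⟩ := mem_image.1 h'
      exact disjoint_left.1 hdisj (hi (mem_filter.2 ⟨mem_univ x, hxi⟩)) hx
    have := hsafe.fiberCard_pos hd0 hlive
    rw [Game.IsOver] at hover
    rw [hover] at this
    simp [fiberCard] at this
  have hpos : 0 < #(h.unclaimed first) := card_pos.2 (nonempty_iff_ne_empty.2 hover)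
  have hdec : ∀ M ⊆ h.unclaimed first, 0 < #M → #(unclaimed first (M :: h)) < m := by
    intro M hM hM0
    have := card_sdiff_add_card_eq_card hM
    rw [unclaimed_cons]
    omega
  cases ht : h.turn first
  · rw [ht] at hsafe
    obtain ⟨M, hM, hMc, hs⟩ := hsafe.exists_move hpd hd
    refine ih _ (hdec M hM (by omega)) (M :: h) rfl (.avoiderMove h M hc hover ht ⟨hM, ?_⟩)
      (disjoint_claimedBy_cons hM hdisj) ?_
    · rw [hMc, ht]
      rfl
    · rwa [turn_cons_of_avoider ht, unclaimed_cons, liveBoxes_cons_of_avoider ht]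
  · rw [ht] at hsafe
    obtain ⟨hM, hMc⟩ := hlegal h hc hover ht
    replace hMc : #(σ h) = min q #(h.unclaimed first) := by
      rw [hMc, ht]
      rfl
    refine ih _ (hdec _ hM (by omega)) (σ h :: h) rfl (.enforcerMove h hc hover ht)
      (disjoint_claimedBy_cons hM hdisj) ?_
    rw [turn_cons_of_enforcer ht, unclaimed_cons, liveBoxes_cons_of_enforcer ht]
    exact hsafe.enforcer_move hd0 hM hMc

end AvoiderEnforcer

theorem corollary1p4 (p q k : ℕ) (hp : 0 < p) (hq : 0 < q) (hk : 0 < k) :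
    ∃ N : ℕ, ∀ n : ℕ, N ≤ n → ∀ first : AvoiderEnforcer.Player,
      ((AvoiderEnforcer.mBoxUniform n k p q).EnforcerHasWinningStrategy first ↔
        ∀ l : ℕ, 1 ≤ l → l ≤ k → Nat.gcd (p + q) l ≤ p) := by
  open AvoiderEnforcer Finset in
  by_cases hg : ∀ l : ℕ, 1 ≤ l → l ≤ k → Nat.gcd (p + q) l ≤ p
  · obtain ⟨N, hN⟩ := exists_enforcerWins hp hq k hg
    -- The extra `q` covers the boxes Enforcer may enter when he moves first.
    refine ⟨N + q, fun n hn first => iff_of_true ?_ hg⟩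
    refine enforcerHasWinningStrategy_of_enforcerWins ?_
    have hfib := fun i => fiberCard_univ (fun _ : Fin n => k) i
    cases first
    · refine hN _ _ _ _ _ (fun i _ => (hfib i).le) ?_
      rw [card_univ, Fintype.card_fin]
      omega
    · have hqX : q ≤ #(univ : Finset ((_ : Fin n) × Fin k)) := by
        rw [card_univ, Fintype.card_sigma]
        simp only [Fintype.card_fin, sum_const, card_univ, smul_eq_mul]
        exact (by omega : q ≤ n).trans (Nat.le_mul_of_pos_right n hk)
      obtain ⟨M, hM, hMc⟩ := exists_subset_card_eq hqX
      refine .enforcer _ _ M (card_pos.1 (by omega)) hM (by rw [hMc, min_eq_left hqX])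
        (hN _ _ _ _ _ (fun i _ => (fiberCard_mono _ sdiff_subset i).trans (hfib i).le) ?_)
      have h1 := card_le_card_sdiff_image_add (Sigma.fst : (_ : Fin n) × Fin k → Fin n) univ M
      rw [card_univ, Fintype.card_fin] at h1
      omega
  · refine ⟨0, fun n _ first => iff_of_false ?_ hg⟩
    push Not at hg
    obtain ⟨l, hl1, hlk, hl⟩ := hg
    exact not_enforcerHasWinningStrategy hp hq hl (Nat.gcd_dvd_left _ _)
      fun _ => (Nat.gcd_le_right _ hl1).trans hlk
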